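/- Let $\mathcal Z$ be a set of samples, $\ell:\mathcal Z\times\mathbb R^d\to\mathbb R$ a loss and $\theta_0\in\mathbb R^d$. A dataset is a finite nonempty family $D=(z_i)_{i\in I}$ in $\mathcal Z$, with $\mathcal L_D(\theta)=\frac1{|I|}\sum_{i}\ell(z_i;\theta)$. For a batch $\mathcal B$ of $b\ge 1$ indices drawn independently and uniformly (with replacement) from $I$, let $g_{\mathcal B}(\theta)=\frac1b\sum_{i\in\mathcal B}\nabla\ell(z_i;\theta)$. SGD on $D$ with step size $\eta>0$ is $\theta_t=\theta_{t-1}-\eta g_{\mathcal B_t}(\theta_{t-1})$ with independent batches $\mathcal B_t$. SGD-R2D with $0\le K\le T$ and noise level $\sigma$: the learning algorithm $A$ runs $T$ steps of SGD on $D$ from $\theta_0$, saves the checkpoint $\theta_{T-K}$, and outputs $\theta_T+\xi$ with $\xi\sim\mathcal N(0,\sigma^2 I_d)$. To unlearn a subset $Z\subset D$, the unlearning algorithm $U$ runs $K$ steps of SGD on $D'=D\setminus Z$ from $\theta_{T-K}$, with fresh batches, and outputs the result plus independent noise $\xi'\sim\mathcal N(0,\sigma^2I_d)$. Let $0\le m<n$.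 SGD-R2D is an $(\epsilon,\delta')$-unlearning algorithm if for every dataset $D$ of size $n$ and every $Z\subset D$ of size $m$, the laws $P$ of $U(A(D),D,Z)$ and $Q$ of $A(D\setminus Z)$ satisfy $P(S)\le e^{\epsilon}Q(S)+\delta'$ and $Q(S)\le e^{\epsilon}P(S)+\delta'$ for all measurable $S\subseteq\mathbb R^d$. Assume, for constants $L>0$ and $B,C\ge0$: 1. for every $z$, $\ell(z;\cdot)$ is differentiable and $\|\nabla\ell(z;\theta_1)-\nabla\ell(z;\theta_2)\|\le L\|\theta_1-\theta_2\|$ for all $\theta_1,\theta_2$; 2. for every dataset $\tilde D$ and every $\theta$, $\mathbb E\|g_{\mathcal B}(\theta)\|^2\le\mathbb E_{z\sim\tilde D}\|\nabla\ell(z;\theta)\|^2\le B\|\nabla\mathcal L_{\tilde D}(\theta)\|^2+C$, where $\mathcal B$ is a batch from $\tilde D$ and $z\sim\tilde D$ is uniform; 3. $\ell\ge0$, and $\ell(z;\theta_0)\le\ell_{\theta_0}$ for all $z$, for a constant $\ell_{\theta_0}$. Let $0<\epsilon\le1$, $0<\delta<1$, and $$\sigma=\frac{\Sigma\sqrt{2\log(1.25/\delta)}}{\epsilon\delta},\qquad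 R=\left(3B\Big(\frac2\eta\ell_{\theta_0}+L\eta C(T-K)\Big)\frac{3n-m}{n-m}+6\,\frac{4n-3m}{n-m}\,C\right)^{1/2}.$$ Then SGD-R2D is an $(\epsilon,2\delta)$-unlearning algorithm in each of the following cases: - (general losses) $\eta LB\le1$ and $\Sigma=\dfrac{(1+\eta L)^T-(1+\eta L)^K}{L}\,R$; - (convex losses) every $\ell(z;\cdot)$ is convex, $\eta\le\frac2L$, and $\Sigma=\eta(T-K)R$; - (strongly convex losses) every $\ell(z;\cdot)$ is $\mu$-strongly convex with $\mu>0$, $\eta\le\frac{\mu}{L^2}$, $\gamma=\sqrt{1-\eta\mu}$, and $\Sigma=\dfrac{\gamma^K-\gamma^T}{\mu}\,R$. -/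

import Mathlib

open MeasureTheory ProbabilityTheory
open scoped ENNReal Gradient RealInnerProductSpace

noncomputable section

namespace Unlearning

/-- The parameter space `ℝ^d` with its Euclidean norm. -/
abbrev Param (d : ℕ) : Type := EuclideanSpace ℝ (Fin d)

/-! ### Datasets, empirical loss and mini-batch gradients

A dataset is a finite nonempty family `D : ι → 𝒵` of samples (repetitions are allowed). -/

section Loss

variable {𝒵 : Type*} {d : ℕ}

/-- The empirical loss `(1/n) ∑ᵢ ℓ(zᵢ; θ)`. -/
def empLoss (ℓ : 𝒵 → Param d → ℝ) {ι : Type} [Fintype ι] (D : ι → 𝒵) (θ : Param d) : ℝ :=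
  (Fintype.card ι : ℝ)⁻¹ * ∑ i, ℓ (D i) θ

/-- The mini-batch gradient estimator `(1/b) ∑_{i ∈ batch} ∇ℓ(zᵢ; θ)`, where a batch is a
sequence of `b` indices. -/
def batchGrad (ℓ : 𝒵 → Param d → ℝ) {ι : Type} (D : ι → 𝒵) {b : ℕ} (batch : Fin b → ι)
    (θ : Param d) : Param d :=
  (b : ℝ)⁻¹ • ∑ j, ∇ (ℓ (D (batch j))) θ

/-- Each `ℓ(z; ·)` is differentiable with `L`-Lipschitz gradient. -/
def IsSmoothLoss (ℓ : 𝒵 → Param d → ℝ) (L : ℝ) : Prop :=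
  ∀ z, Differentiable ℝ (ℓ z) ∧ ∀ θ₁ θ₂, ‖∇ (ℓ z) θ₁ - ∇ (ℓ z) θ₂‖ ≤ L * ‖θ₁ - θ₂‖

/-- Each `ℓ(z; ·)` is convex (first-order form). -/
def IsConvexLoss (ℓ : 𝒵 → Param d → ℝ) : Prop :=
  ∀ z θ₁ θ₂, ℓ z θ₂ + ⟪∇ (ℓ z) θ₂, θ₁ - θ₂⟫ ≤ ℓ z θ₁

/-- Each `ℓ(z; ·)` is `μ`-strongly convex (first-order form). -/
def IsStronglyConvexLoss (ℓ : 𝒵 → Param d → ℝ) (μ : ℝ) : Prop :=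
  ∀ z θ₁ θ₂, ℓ z θ₂ + ⟪∇ (ℓ z) θ₂, θ₁ - θ₂⟫ + μ / 2 * ‖θ₂ - θ₁‖ ^ 2 ≤ ℓ z θ₁

/-- Relatively bounded second moment: for every dataset, the second moment of the estimator built
from a batch of `b` indices drawn uniformly with replacement is at most the mean squared
per-sample gradient norm, which is at most `B ‖∇ empirical loss‖² + C`. -/
def HasRelBoundedSecondMoment (ℓ : 𝒵 → Param d → ℝ) (b : ℕ) (B C : ℝ) : Prop :=
  ∀ (ι : Type) [Fintype ι] [Nonempty ι] (D : ι → 𝒵) (θ : Param d),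
    (Fintype.card (Fin b → ι) : ℝ)⁻¹ * ∑ batch : Fin b → ι, ‖batchGrad ℓ D batch θ‖ ^ 2
        ≤ (Fintype.card ι : ℝ)⁻¹ * ∑ i, ‖∇ (ℓ (D i)) θ‖ ^ 2 ∧
    (Fintype.card ι : ℝ)⁻¹ * ∑ i, ‖∇ (ℓ (D i)) θ‖ ^ 2
        ≤ B * ‖∇ (empLoss ℓ D) θ‖ ^ 2 + C

/-- The loss is nonnegative, and bounded by `ℓ₀` at the initial point `θ₀`. -/
def IsBoundedAtInit (ℓ : 𝒵 → Param d → ℝ) (θ₀ : Param d) (ℓ₀ : ℝ) : Prop :=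
  (∀ z θ, 0 ≤ ℓ z θ) ∧ ∀ z, ℓ z θ₀ ≤ ℓ₀

end Loss

/-! ### Certified unlearning -/

section Certified

/-- `(ε, δ)`-indistinguishability of two laws. -/
def Indistinguishable {Ω : Type*} [MeasurableSpace Ω] (ε δ : ℝ) (P Q : Measure Ω) : Prop :=
  ∀ S : Set Ω, MeasurableSet S →
    P S ≤ ENNReal.ofReal (Real.exp ε) * Q S + ENNReal.ofReal δ ∧
    Q S ≤ ENNReal.ofReal (Real.exp ε) * P S + ENNReal.ofReal δ

/-- The law of an output drawn from `κ s`, where the state `s` has the discrete law `p`. -/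
def mixture {State Ω : Type*} [MeasurableSpace Ω] (p : PMF State) (κ : State → Measure Ω) :
    Measure Ω :=
  Measure.sum fun s => p s • κ s

/-- The retained dataset, obtained by deleting the samples with index in `Z`. -/
def retained {𝒵 ι : Type*} (D : ι → 𝒵) (Z : Finset ι) : {i // i ∉ Z} → 𝒵 :=
  fun i => D i

/-- A randomized learning algorithm: on a dataset it reaches a random internal state, of discrete
law `train D`; from the internal state `s` it outputs a model of law `output s`. -/
structure LearningAlgorithm (𝒵 State Ω : Type*) [MeasurableSpace Ω] where
  train : ∀ (ι : Type) [Fintype ι] [Nonempty ι], (ι → 𝒵) → PMF State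
  output : State → Measure Ω

/-- The law of the model that the learning algorithm outputs on the dataset `D`. -/
def LearningAlgorithm.law {𝒵 State Ω : Type*} [MeasurableSpace Ω]
    (A : LearningAlgorithm 𝒵 State Ω) {ι : Type} [Fintype ι] [Nonempty ι] (D : ι → 𝒵) :
    Measure Ω :=
  mixture (A.train ι D) A.output

/-- A randomized unlearning algorithm: from the state saved by the learning algorithm, the
dataset and the set of indices to be unlearned, it produces a model of law `U Z D s`. -/
abbrev UnlearningAlgorithm (𝒵 State Ω : Type*) [MeasurableSpace Ω] : Type _ :=
  ∀ {ι : Type} [Fintype ι] (Z : Finset ι) [Nonempty {i // i ∉ Z}],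
    (ι → 𝒵) → State → Measure Ω

/-- `U` is an `(ε, δ)`-certified unlearning algorithm for `A`, for datasets `D` of size `n` and
unlearned sets `Z` of size `m`: the laws of `U(A(D), D, Z)` and of `A(D ∖ Z)` are
`(ε, δ)`-indistinguishable. -/
def IsCertifiedUnlearning {𝒵 State Ω : Type*} [MeasurableSpace Ω] (ε δ : ℝ) (n m : ℕ)
    (A : LearningAlgorithm 𝒵 State Ω) (U : UnlearningAlgorithm 𝒵 State Ω) : Prop :=
  ∀ (D : Fin n → 𝒵) (Z : Finset (Fin n)), Z.card = m →
    ∀ [Nonempty (Fin n)] [Nonempty {i // i ∉ Z}],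
      Indistinguishable ε δ (mixture (A.train (Fin n) D) (U Z D)) (A.law (retained D Z))

end Certified

/-! ### SGD and rewind-to-delete -/

section Algorithm

variable {𝒵 : Type*} {d : ℕ}

/-- The law of the iterate `θ_t` of SGD on the dataset `D` started at `θ`, with step size `η` and
independent batches of `b` indices drawn uniformly with replacement. -/
def sgd (ℓ : 𝒵 → Param d → ℝ) (η : ℝ) (b : ℕ) {ι : Type} [Fintype ι] [Nonempty ι]
    (D : ι → 𝒵) (θ : Param d) : ℕ → PMF (Param d)
  | 0 => PMF.pure θ
  | t + 1 => (sgd ℓ η b D θ t).bind fun w =>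
      (PMF.uniformOfFintype (Fin b → ι)).map fun batch => w - η • batchGrad ℓ D batch w

/-- The isotropic Gaussian `𝒩(θ, σ² I)`: the law of `θ + ξ` with `ξ ∼ 𝒩(0, σ² I)`. -/
def gaussianAround (σ : ℝ) (θ : Param d) : Measure (Param d) :=
  (stdGaussian (Param d)).map fun x => θ + σ • x

/-- The SGD-R2D learning algorithm: `T` SGD steps from `θ₀`. The internal state is the pair of the
checkpoint `θ_{T-K}` and the last iterate `θ_T`; the output is `θ_T` plus Gaussian noise. -/
def r2dLearn (ℓ : 𝒵 → Param d → ℝ) (η : ℝ) (b T K : ℕ) (θ₀ : Param d) (σ : ℝ) :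
    LearningAlgorithm 𝒵 (Param d × Param d) (Param d) where
  train := fun _ _ _ D => (sgd ℓ η b D θ₀ (T - K)).bind fun c =>
    (sgd ℓ η b D c K).map fun w => (c, w)
  output := fun s => gaussianAround σ s.2

/-- The SGD-R2D unlearning algorithm: `K` SGD steps on the retained dataset from the saved
checkpoint, plus Gaussian noise. -/
def r2dUnlearn (ℓ : 𝒵 → Param d → ℝ) (η : ℝ) (b K : ℕ) (σ : ℝ) :
    UnlearningAlgorithm 𝒵 (Param d × Param d) (Param d) :=
  fun Z _ D s =>
    haveI : DecidablePred fun i => i ∉ Z := Classical.decPred _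
    mixture (sgd ℓ η b (retained D Z) s.1 K) (gaussianAround σ)

/-- SGD-R2D (with `T` training steps, `K` unlearning steps and noise level `σ`) is an
`(ε, δ)`-unlearning algorithm for datasets of size `n` and unlearned sets of size `m`. -/
def SGDR2DUnlearns (ℓ : 𝒵 → Param d → ℝ) (η : ℝ) (b T K : ℕ) (θ₀ : Param d) (n m : ℕ)
    (σ ε δ : ℝ) : Prop :=
  IsCertifiedUnlearning ε δ n m (r2dLearn ℓ η b T K θ₀ σ) (r2dUnlearn ℓ η b K σ)

/-- The noise level `σ = Σ √(2 log(1.25/δ)) / (ε δ)` for a first-moment bound `Σ`. -/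
def noiseLevel (Sig ε δ : ℝ) : ℝ :=
  Sig * √(2 * Real.log (1.25 / δ)) / (ε * δ)

/-- The square-root factor common to the three values of `Σ`. -/
def noiseFactor (L B C ℓ₀ η : ℝ) (n m T K : ℕ) : ℝ :=
  √(3 * B * (2 / η * ℓ₀ + L * η * C * ((T : ℝ) - K)) * ((3 * (n : ℝ) - m) / ((n : ℝ) - m))
    + 6 * ((4 * (n : ℝ) - 3 * m) / ((n : ℝ) - m)) * C)

end Algorithm

end Unlearning

end

/-! The argument is a worst-case coupling, with no moment of the SGD trajectory. Gradients at `θ₀`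
are bounded uniformly over samples: nonnegativity and smoothness give `‖∇ℓ(z;θ₀)‖² ≤ 2Lℓ₀`, and the
moment hypothesis on a one-point dataset gives `‖∇ℓ(z;θ₀)‖² ≤ B‖∇ℓ(z;θ₀)‖² + C`. Let `ρ` be a bound
on these norms.

If every gradient step is `q`-Lipschitz (`1 + ηL`, `1` or `γ` in the three cases), every run of `N =
T - K` steps stays within `ηρ ∑_{j<N} q^j` of `θ₀`, whatever the dataset
(`norm_sub_le_of_mem_support_sgd`). The checkpoints of training and retraining are thus at most
twice that far apart. The last `K` steps use the same retained data on both sides; shared batches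
multiply the gap by at most `q^K` (`discreteMean_sgd_le_add`).

The resulting gap is at most `Σ`, and `σ ≥ Σ/δ` when `δ < 1/2`, so the Gaussian outputs differ by at
most `2δ` in total variation (`gaussianAround_noiseLevel_le`). Since `e^ε ≥ 1`, this is stronger
than indistinguishability. What remains is to compare `ρ` with `R`; the weak bound `R² ≥ 18Bℓ₀/η +
24C` (`le_noiseFactor`) suffices in all three cases. -/

namespace Unlearning

/-! ### Total variation between translated Gaussians. -/

section Gaussian

variable {ι : Type*} [Fintype ι]

lemma integral_exp_inner_stdGaussian (a : EuclideanSpace ℝ ι) :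
    Integrable (fun x => Real.exp ⟪a, x⟫) (stdGaussian (EuclideanSpace ℝ ι)) ∧
      ∫ x, Real.exp ⟪a, x⟫ ∂stdGaussian (EuclideanSpace ℝ ι) = Real.exp (‖a‖ ^ 2 / 2) := by
  have hmap : (stdGaussian (EuclideanSpace ℝ ι)).map (fun x => ⟪a, x⟫)
      = gaussianReal 0 (‖a‖₊ ^ 2) := by
    have h := IsGaussian.map_eq_gaussianReal (μ := stdGaussian (EuclideanSpace ℝ ι))
      (innerSL ℝ a)
    rw [integral_strongDual_stdGaussian, variance_dual_stdGaussian, innerSL_apply_norm] at h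
    have h2 : (‖a‖ ^ 2).toNNReal = ‖a‖₊ ^ 2 := by
      ext; simp
    rw [h2] at h
    exact h
  have hm : AEMeasurable (fun x => ⟪a, x⟫) (stdGaussian (EuclideanSpace ℝ ι)) := by fun_prop
  constructor
  · have h := integrable_exp_mul_gaussianReal (μ := 0) (v := ‖a‖₊ ^ 2) 1
    rw [← hmap] at h
    simpa [Function.comp_def] using (integrable_map_measure (by fun_prop) hm).1 h
  · have h := mgf_gaussianReal hmap 1
    simpa [mgf] using h

/-- The coordinates are independent, so the integral factors into one-dimensional complex moment
generating functions at `h i + t i * I`. It provides the characteristic function of the tilted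
Gaussian. -/
lemma integral_cexp_inner_stdGaussian (h t : EuclideanSpace ℝ ι) :
    ∫ x, Complex.exp ((⟪h, x⟫ : ℝ) + (⟪x, t⟫ : ℝ) * Complex.I)
        ∂stdGaussian (EuclideanSpace ℝ ι)
      = Complex.exp (((‖h‖ ^ 2 - ‖t‖ ^ 2) / 2 : ℝ) + (⟪h, t⟫ : ℝ) * Complex.I) := by
  rw [← map_pi_eq_stdGaussian, integral_map (by fun_prop) (by fun_prop)]
  have hprod : ∀ x : ι → ℝ,
      Complex.exp ((⟪h, WithLp.toLp 2 x⟫ : ℝ) + (⟪WithLp.toLp 2 x, t⟫ : ℝ) * Complex.I)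
        = ∏ i, Complex.exp (((h i : ℂ) + t i * Complex.I) * x i) := by
    intro x
    rw [← Complex.exp_sum]
    congr 1
    simp only [PiLp.inner_apply, RCLike.inner_apply, conj_trivial]
    push_cast
    rw [Finset.sum_mul, ← Finset.sum_add_distrib]
    exact Finset.sum_congr rfl fun i _ => by ring
  simp_rw [hprod]
  rw [integral_fintype_prod_eq_prod
    (f := fun i (x : ℝ) => Complex.exp (((h i : ℂ) + t i * Complex.I) * x))]
  have hone : ∀ i, ∫ x : ℝ, Complex.exp (((h i : ℂ) + t i * Complex.I) * x) ∂gaussianReal 0 1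
      = Complex.exp (((h i : ℂ) + t i * Complex.I) ^ 2 / 2) := by
    intro i
    have := complexMGF_id_gaussianReal (μ := 0) (v := 1) ((h i : ℂ) + t i * Complex.I)
    simpa [complexMGF] using this
  simp_rw [hone]
  rw [← Complex.exp_sum]
  congr 1
  rw [EuclideanSpace.real_norm_sq_eq, EuclideanSpace.real_norm_sq_eq]
  simp only [PiLp.inner_apply, RCLike.inner_apply, conj_trivial]
  push_cast
  rw [Finset.sum_mul, ← Finset.sum_sub_distrib, Finset.sum_div, ← Finset.sum_add_distrib]
  refine Finset.sum_congr rfl fun i _ => ?_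
  linear_combination ((t i : ℂ) ^ 2 / 2) * Complex.I_sq

/-- Translating the standard Gaussian by `h` tilts it by the linear functional `⟪h, ·⟫`. -/
lemma stdGaussian_map_add_eq_tilted (h : EuclideanSpace ℝ ι) :
    (stdGaussian (EuclideanSpace ℝ ι)).map (fun x => x + h)
      = (stdGaussian (EuclideanSpace ℝ ι)).tilted fun x => ⟪h, x⟫ := by
  obtain ⟨hint, hval⟩ := integral_exp_inner_stdGaussian h
  have := isProbabilityMeasure_tilted hint
  have : IsProbabilityMeasure ((stdGaussian (EuclideanSpace ℝ ι)).map (fun x => x + h)) :=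
    Measure.isProbabilityMeasure_map (by fun_prop)
  apply Measure.ext_of_charFun (E := EuclideanSpace ℝ ι)
  ext t
  rw [charFun_map_add_const, charFun_stdGaussian, charFun_apply, integral_tilted, hval]
  have hrw : ∀ x : EuclideanSpace ℝ ι,
      (Real.exp ⟪h, x⟫ / Real.exp (‖h‖ ^ 2 / 2)) • Complex.exp ((⟪x, t⟫ : ℝ) * Complex.I)
        = Complex.exp (-((‖h‖ ^ 2 / 2 : ℝ) : ℂ))
          * Complex.exp ((⟪h, x⟫ : ℝ) + (⟪x, t⟫ : ℝ) * Complex.I) := by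
    intro x
    rw [Complex.real_smul, ← Real.exp_sub, Complex.ofReal_exp, ← Complex.exp_add,
      ← Complex.exp_add]
    congr 1
    push_cast
    ring
  simp_rw [hrw]
  rw [integral_const_mul, integral_cexp_inner_stdGaussian, ← Complex.exp_add, ← Complex.exp_add]
  congr 1
  push_cast
  ring

/-- A translation of length at most `c ≤ 1` changes standard Gaussian probabilities by at most
`3c/2`. -/
lemma stdGaussian_le_preimage_add (h : EuclideanSpace ℝ ι) {c : ℝ} (hc : 0 < c) (hc1 : c ≤ 1)
    (hh : ‖h‖ ≤ c) {S : Set (EuclideanSpace ℝ ι)} (hS : MeasurableSet S) :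
    stdGaussian (EuclideanSpace ℝ ι) ((fun x => x + h) ⁻¹' S)
      ≤ stdGaussian (EuclideanSpace ℝ ι) S + ENNReal.ofReal (3 / 2 * c) := by
  set μ := stdGaussian (EuclideanSpace ℝ ι)
  obtain ⟨hint, hval⟩ := integral_exp_inner_stdGaussian h
  obtain ⟨hint2, hval2⟩ := integral_exp_inner_stdGaussian ((2 : ℝ) • h)
  set E := Real.exp (‖h‖ ^ 2 / 2) with hE
  have hE0 : 0 < E := Real.exp_pos _
  -- `p` is the density of the translated Gaussian; its second moment `exp ‖h‖²` gives the
  -- χ²-divergence `exp ‖h‖² - 1 ≤ 2c²`.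
  set p : EuclideanSpace ℝ ι → ℝ := fun x => Real.exp ⟪h, x⟫ / E with hp
  have hpi : Integrable p μ := hint.div_const _
  have hp1 : ∫ x, p x ∂μ = 1 := by
    rw [hp, integral_div, hval, div_self hE0.ne']
  have hsq : ∀ x, p x ^ 2 = Real.exp ⟪(2 : ℝ) • h, x⟫ / E ^ 2 := by
    intro x
    simp only [hp, div_pow, real_inner_smul_left]
    rw [two_mul, Real.exp_add, sq]
  have hp2i : Integrable (fun x => p x ^ 2) μ := by
    simp_rw [hsq]; exact hint2.div_const _
  have hp2 : ∫ x, p x ^ 2 ∂μ = Real.exp (‖h‖ ^ 2) := by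
    simp_rw [hsq]
    rw [integral_div, hval2, hE, ← Real.exp_nat_mul, ← Real.exp_sub, norm_smul]
    congr 1
    simp
    ring
  have hkey : μ.real ((fun x => x + h) ⁻¹' S) = ∫ x in S, p x ∂μ := by
    rw [← map_measureReal_apply (by fun_prop) hS, stdGaussian_map_add_eq_tilted,
      measureReal_def, tilted_apply_eq_ofReal_integral' _ hS, ENNReal.toReal_ofReal, hval]
    exact setIntegral_nonneg hS fun x _ => by positivity
  have hchi : Integrable (fun x => ((p x - 1) ^ 2 / c + c) / 2) μ := by
    have : (fun x => ((p x - 1) ^ 2 / c + c) / 2)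
        = fun x => ((p x ^ 2 - 2 * p x + 1) / c + c) / 2 := by ext x; ring
    rw [this]
    exact ((((hp2i.sub (hpi.const_mul 2)).add (integrable_const 1)).div_const c).add
      (integrable_const c)).div_const 2
  have hchiv : ∫ x, ((p x - 1) ^ 2 / c + c) / 2 ∂μ
      = ((Real.exp (‖h‖ ^ 2) - 1) / c + c) / 2 := by
    have : (fun x => ((p x - 1) ^ 2 / c + c) / 2)
        = fun x => p x ^ 2 * (1 / (2 * c)) - p x * (1 / c) + (1 / (2 * c) + c / 2) := by
      ext x; field_simp; ring
    have hdiff : Integrable (fun x => p x ^ 2 * (1 / (2 * c)) - p x * (1 / c)) μ :=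
      (hp2i.mul_const _).sub (hpi.mul_const _)
    rw [this, integral_add hdiff (integrable_const _),
      integral_sub (hp2i.mul_const _) (hpi.mul_const _), integral_mul_const, integral_mul_const,
      hp1, hp2]
    simp
    field_simp
    ring
  have hh2 : ‖h‖ ^ 2 ≤ c ^ 2 := by gcongr
  have hexp : Real.exp (‖h‖ ^ 2) - 1 ≤ 2 * c ^ 2 := by
    have h1 : |‖h‖ ^ 2| ≤ 1 := by rw [abs_of_nonneg (by positivity)]; nlinarith
    have h2 := Real.abs_exp_sub_one_le h1
    rw [abs_of_nonneg (by positivity : (0 : ℝ) ≤ ‖h‖ ^ 2)] at h2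
    linarith [le_abs_self (Real.exp (‖h‖ ^ 2) - 1)]
  have hreal : μ.real ((fun x => x + h) ⁻¹' S) ≤ μ.real S + 3 / 2 * c := by
    rw [hkey]
    calc ∫ x in S, p x ∂μ
        ≤ ∫ x in S, (1 + ((p x - 1) ^ 2 / c + c) / 2) ∂μ := by
          refine setIntegral_mono hpi.integrableOn
            ((integrable_const 1).add hchi).integrableOn fun x => ?_
          -- AM-GM with weight `c` stands in for Cauchy–Schwarz; with χ² at most `2c²` it integrates
          -- to `(2c + c)/2`.
          have : p x - 1 ≤ ((p x - 1) ^ 2 / c + c) / 2 := by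
            rw [le_div_iff₀ two_pos, ← sub_nonneg]
            have : (p x - 1) ^ 2 / c + c - (p x - 1) * 2 = (p x - 1 - c) ^ 2 / c := by
              field_simp; ring
            rw [this]; positivity
          change p x ≤ _
          linarith
      _ = μ.real S + ∫ x in S, ((p x - 1) ^ 2 / c + c) / 2 ∂μ := by
          rw [integral_add (integrable_const 1).integrableOn hchi.integrableOn]
          simp
      _ ≤ μ.real S + ∫ x, ((p x - 1) ^ 2 / c + c) / 2 ∂μ := by
          gcongr
          · exact ae_of_all _ fun x => by change 0 ≤ _; positivity
          · exact Measure.restrict_le_self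
      _ ≤ μ.real S + 3 / 2 * c := by
          rw [hchiv]
          have : (Real.exp (‖h‖ ^ 2) - 1) / c ≤ 2 * c := by
            rw [div_le_iff₀ hc]; nlinarith
          linarith
  rw [← ofReal_measureReal (μ := μ), ← ofReal_measureReal (μ := μ) (s := S),
    ← ENNReal.ofReal_add measureReal_nonneg (by positivity)]
  exact ENNReal.ofReal_le_ofReal hreal

instance isProbabilityMeasure_gaussianAround {d : ℕ} (σ : ℝ) (θ : Param d) :
    IsProbabilityMeasure (gaussianAround σ θ) :=
  Measure.isProbabilityMeasure_map (by fun_prop)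

/-- At noise level `σ = Σ √(2 log(1.25/δ)) / (ε δ)`, isotropic Gaussians whose centres are at
distance at most `Σ` are at total variation distance at most `2 δ`. -/
lemma gaussianAround_noiseLevel_le {d : ℕ} {Sig ε δ : ℝ} (hε : 0 < ε) (hε1 : ε ≤ 1) (hδ : 0 < δ)
    {x y : Param d} (hxy : ‖x - y‖ ≤ Sig) {S : Set (Param d)} (hS : MeasurableSet S) :
    gaussianAround (noiseLevel Sig ε δ) x S
      ≤ gaussianAround (noiseLevel Sig ε δ) y S + ENNReal.ofReal (2 * δ) := by
  -- For `δ ≥ 1/2` the slack `2δ` already exceeds any probability. Otherwise `1.25/δ ≥ 2.5 ≥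
  -- e^(1/2)`, so the square root in the noise level is at least `1 ≥ ε`.
  rcases le_or_gt (1 / 2) δ with hδ2 | hδ2
  · refine le_add_left (prob_le_one.trans ?_)
    rw [← ENNReal.ofReal_one]
    exact ENNReal.ofReal_le_ofReal (by linarith)
  rcases ((norm_nonneg _).trans hxy).eq_or_lt with hSig | hSig
  · have : x = y := sub_eq_zero.1 (norm_le_zero_iff.1 (hxy.trans hSig.ge))
    rw [this]
    exact le_self_add
  set σ := noiseLevel Sig ε δ with hσ
  have hlog : 1 ≤ √(2 * Real.log (1.25 / δ)) := by
    rw [Real.one_le_sqrt]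
    have h1 : (2.5 : ℝ) ≤ 1.25 / δ := by rw [le_div_iff₀ hδ]; linarith
    have h2 : 1 / 2 ≤ Real.log (1.25 / δ) := by
      rw [Real.le_log_iff_exp_le (by linarith)]
      refine le_trans ?_ h1
      have h3 : Real.exp (1 / 2) ^ 2 = Real.exp 1 := by
        rw [← Real.exp_nat_mul]; norm_num
      nlinarith [Real.exp_one_lt_d9, Real.exp_pos (1 / 2)]
    linarith
  have hσ' : Sig / δ ≤ σ := by
    rw [hσ, noiseLevel, div_le_div_iff₀ hδ (by positivity)]
    have : ε ≤ √(2 * Real.log (1.25 / δ)) := hε1.trans hlog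
    have h2 := mul_le_mul_of_nonneg_left this (by positivity : 0 ≤ Sig * δ)
    linarith
  have hσ0 : 0 < σ := lt_of_lt_of_le (by positivity) hσ'
  have hm : ∀ θ : Param d, Measurable fun z : Param d => θ + σ • z := fun θ => by fun_prop
  have hpre : (fun z : Param d => x + σ • z) ⁻¹' S
      = (fun z => z + σ⁻¹ • (x - y)) ⁻¹' ((fun z => y + σ • z) ⁻¹' S) := by
    ext z
    simp only [Set.mem_preimage, smul_add, smul_inv_smul₀ hσ0.ne']
    rw [show y + (σ • z + (x - y)) = x + σ • z by abel]
  rw [gaussianAround, gaussianAround, Measure.map_apply (hm x) hS, Measure.map_apply (hm y) hS,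
    hpre]
  refine (stdGaussian_le_preimage_add (σ⁻¹ • (x - y)) hδ (by linarith) ?_ (hm y hS)).trans ?_
  · rw [norm_smul, Real.norm_of_nonneg (by positivity), inv_mul_le_iff₀ hσ0]
    rw [div_le_iff₀ hδ] at hσ'
    linarith
  · gcongr
    linarith

end Gaussian

/-! ### Inequalities for smooth and convex functions. -/

section Smooth

lemma norm_sub_smul_sub_sq {F : Type*} [NormedAddCommGroup F] [InnerProductSpace ℝ F] (η : ℝ)
    (x y g h : F) :
    ‖(x - η • g) - (y - η • h)‖ ^ 2
      = ‖x - y‖ ^ 2 - 2 * η * ⟪g - h, x - y⟫ + η ^ 2 * ‖g - h‖ ^ 2 := by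
  rw [show (x - η • g) - (y - η • h) = (x - y) - η • (g - h) by rw [smul_sub]; abel,
    norm_sub_sq_real, real_inner_smul_right, norm_smul, mul_pow, Real.norm_eq_abs, sq_abs,
    real_inner_comm]
  ring

variable {F : Type*} [NormedAddCommGroup F] [InnerProductSpace ℝ F] [CompleteSpace F]

/-- The descent lemma for a function with `L`-Lipschitz gradient. -/
lemma le_add_inner_gradient_add_sq {f : F → ℝ} {L : ℝ} (hf : Differentiable ℝ f)
    (hlip : ∀ x y, ‖∇ f x - ∇ f y‖ ≤ L * ‖x - y‖) (x v : F) :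
    f (x + v) ≤ f x + ⟪∇ f x, v⟫ + L / 2 * ‖v‖ ^ 2 := by
  -- `φ` is the gap in the quadratic upper bound along the segment: it vanishes at `0`, and the
  -- Lipschitz gradient makes it nondecreasing.
  set φ : ℝ → ℝ := fun t => f x + t * ⟪∇ f x, v⟫ + L / 2 * ‖v‖ ^ 2 * t ^ 2 - f (x + t • v)
  have hφ : ∀ t, HasDerivAt φ
      (⟪∇ f x, v⟫ + L / 2 * ‖v‖ ^ 2 * (2 * t) - ⟪∇ f (x + t • v), v⟫) t := by
    intro t
    have h1 : HasDerivAt (fun s : ℝ => x + s • v) v t := by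
      simpa using ((hasDerivAt_id t).smul_const v).const_add x
    have h2 : HasDerivAt (fun s : ℝ => f (x + s • v)) ⟪∇ f (x + t • v), v⟫ t := by
      have := (hf (x + t • v)).hasGradientAt.hasFDerivAt.comp_hasDerivAt t h1
      rwa [InnerProductSpace.toDual_apply_apply] at this
    have h3 : HasDerivAt (fun s : ℝ => f x + s * ⟪∇ f x, v⟫ + L / 2 * ‖v‖ ^ 2 * s ^ 2)
        (⟪∇ f x, v⟫ + L / 2 * ‖v‖ ^ 2 * (2 * t)) t := by
      have h4 := ((hasDerivAt_id t).mul_const ⟪∇ f x, v⟫).const_add (f x)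
      have h5 := ((hasDerivAt_id t).pow 2).const_mul (L / 2 * ‖v‖ ^ 2)
      refine (h4.add h5).congr_deriv ?_
      simp
    exact h3.sub h2
  have hmono : MonotoneOn φ (Set.Icc 0 1) := by
    refine monotoneOn_of_deriv_nonneg (convex_Icc 0 1)
      (fun t _ => (hφ t).continuousAt.continuousWithinAt)
      (fun t _ => (hφ t).differentiableAt.differentiableWithinAt) fun t ht => ?_
    rw [interior_Icc] at ht
    rw [(hφ t).deriv]
    have h1 : ⟪∇ f (x + t • v) - ∇ f x, v⟫ ≤ L * (t * ‖v‖) * ‖v‖ := by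
      refine (real_inner_le_norm _ _).trans ?_
      gcongr
      have := hlip (x + t • v) x
      rwa [add_sub_cancel_left, norm_smul, Real.norm_of_nonneg ht.1.le] at this
    rw [inner_sub_left] at h1
    nlinarith
  have := hmono (Set.left_mem_Icc.2 zero_le_one) (Set.right_mem_Icc.2 zero_le_one) zero_le_one
  simp only [φ, one_smul, zero_smul, add_zero] at this
  linarith

/-- A gradient step of length `1/L` lowers `f` by at least `‖∇ f x‖² / (2L)`, and the value reached
is still nonnegative. -/
lemma norm_gradient_sq_le {f : F → ℝ} {L : ℝ} (hL : 0 < L) (hf : Differentiable ℝ f)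
    (hlip : ∀ x y, ‖∇ f x - ∇ f y‖ ≤ L * ‖x - y‖) (h0 : ∀ x, 0 ≤ f x) (x : F) :
    ‖∇ f x‖ ^ 2 ≤ 2 * L * f x := by
  have h := le_add_inner_gradient_add_sq hf hlip x (-(L⁻¹ • ∇ f x))
  rw [inner_neg_right, real_inner_smul_right, real_inner_self_eq_norm_sq, norm_neg, norm_smul,
    Real.norm_of_nonneg (by positivity)] at h
  have h1 := (h0 _).trans h
  have h2 : f x + -(L⁻¹ * ‖∇ f x‖ ^ 2) + L / 2 * (L⁻¹ * ‖∇ f x‖) ^ 2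
      = (2 * L * f x - ‖∇ f x‖ ^ 2) / (2 * L) := by
    field_simp; ring
  rw [h2, le_div_iff₀ (by positivity)] at h1
  linarith

/-- Cocoercivity of the gradient of a smooth convex function. -/
lemma norm_gradient_sub_sq_le_inner {f : F → ℝ} {L : ℝ} (hL : 0 < L) (hf : Differentiable ℝ f)
    (hlip : ∀ x y, ‖∇ f x - ∇ f y‖ ≤ L * ‖x - y‖)
    (hconv : ∀ x y, f y + ⟪∇ f y, x - y⟫ ≤ f x) (x y : F) :
    ‖∇ f x - ∇ f y‖ ^ 2 ≤ L * ⟪∇ f x - ∇ f y, x - y⟫ := by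
  -- At the point `y + L⁻¹ (∇ f x - ∇ f y)`, the tangent at `x` bounds `f` below and the descent
  -- lemma from `y` bounds it above. Adding `key` to its version with `x` and `y` exchanged gives
  -- cocoercivity.
  have key : ∀ x y, f x + ⟪∇ f x, y - x⟫ + 1 / (2 * L) * ‖∇ f x - ∇ f y‖ ^ 2 ≤ f y := by
    intro x y
    set g := ∇ f x - ∇ f y
    have h1 := hconv (y + L⁻¹ • g) x
    have h2 := le_add_inner_gradient_add_sq hf hlip y (L⁻¹ • g)
    have h3 := h1.trans h2
    rw [show y + L⁻¹ • g - x = (y - x) + L⁻¹ • g by abel, inner_add_right, real_inner_smul_right,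
      real_inner_smul_right, norm_smul, Real.norm_of_nonneg (by positivity)] at h3
    have h4 : ⟪∇ f x, g⟫ - ⟪∇ f y, g⟫ = ‖g‖ ^ 2 := by
      rw [← inner_sub_left, real_inner_self_eq_norm_sq]
    have h5 : L⁻¹ * ⟪∇ f x, g⟫ - L⁻¹ * ⟪∇ f y, g⟫ = L⁻¹ * ‖g‖ ^ 2 := by
      rw [← mul_sub, h4]
    have h6 : L / 2 * (L⁻¹ * ‖g‖) ^ 2 = 1 / (2 * L) * ‖g‖ ^ 2 := by field_simp
    have h7 : L⁻¹ * ‖g‖ ^ 2 = 2 * (1 / (2 * L) * ‖g‖ ^ 2) := by field_simp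
    linarith
  have h1 := key x y
  have h2 := key y x
  rw [norm_sub_rev (∇ f y)] at h2
  rw [← neg_sub x y, inner_neg_right] at h1
  have h3 : 2 * (1 / (2 * L) * ‖∇ f x - ∇ f y‖ ^ 2) ≤ ⟪∇ f x - ∇ f y, x - y⟫ := by
    rw [inner_sub_left]; linarith
  have h4 : 2 * (1 / (2 * L) * ‖∇ f x - ∇ f y‖ ^ 2) = ‖∇ f x - ∇ f y‖ ^ 2 / L := by field_simp
  rw [h4, div_le_iff₀ hL] at h3
  linarith

end Smooth

/-! ### Lipschitz constants of the gradient step. -/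

section Step

variable {𝒵 : Type*} {d : ℕ} {ℓ : 𝒵 → Param d → ℝ} {L η : ℝ}

/-- Every single-sample gradient step is `q`-Lipschitz. -/
def HasLipschitzStep (ℓ : 𝒵 → Param d → ℝ) (η q : ℝ) : Prop :=
  ∀ z θ₁ θ₂, ‖(θ₁ - η • ∇ (ℓ z) θ₁) - (θ₂ - η • ∇ (ℓ z) θ₂)‖ ≤ q * ‖θ₁ - θ₂‖

lemma IsSmoothLoss.hasLipschitzStep (hs : IsSmoothLoss ℓ L) (hη : 0 ≤ η) :
    HasLipschitzStep ℓ η (1 + η * L) := by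
  intro z θ₁ θ₂
  rw [show (θ₁ - η • ∇ (ℓ z) θ₁) - (θ₂ - η • ∇ (ℓ z) θ₂)
    = (θ₁ - θ₂) - η • (∇ (ℓ z) θ₁ - ∇ (ℓ z) θ₂) by rw [smul_sub]; abel]
  refine (norm_sub_le _ _).trans ?_
  rw [norm_smul, Real.norm_of_nonneg hη]
  nlinarith [mul_le_mul_of_nonneg_left ((hs z).2 θ₁ θ₂) hη]

lemma IsConvexLoss.hasLipschitzStep (hc : IsConvexLoss ℓ) (hs : IsSmoothLoss ℓ L) (hL : 0 < L)
    (hη : 0 ≤ η) (hηL : η ≤ 2 / L) : HasLipschitzStep ℓ η 1 := by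
  intro z θ₁ θ₂
  rw [one_mul]
  refine le_of_sq_le_sq ?_ (norm_nonneg _)
  rw [norm_sub_smul_sub_sq]
  have h1 := norm_gradient_sub_sq_le_inner hL (hs z).1 (hs z).2 (hc z) θ₁ θ₂
  rw [le_div_iff₀ hL] at hηL
  set I := ⟪∇ (ℓ z) θ₁ - ∇ (ℓ z) θ₂, θ₁ - θ₂⟫
  have hI : 0 ≤ I := by
    by_contra! hI
    nlinarith [sq_nonneg ‖∇ (ℓ z) θ₁ - ∇ (ℓ z) θ₂‖]
  have h2 : η ^ 2 * ‖∇ (ℓ z) θ₁ - ∇ (ℓ z) θ₂‖ ^ 2 ≤ η ^ 2 * (L * I) := by gcongr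
  have h3 : η * L * (η * I) ≤ 2 * (η * I) := by gcongr
  nlinarith

/-- Strong monotonicity contributes `-2ημ`, and the quadratic term at most `η²L² ≤ ημ`. The squared
form keeps its content when `1 - η * μ < 0`, where it forces the space to be trivial. -/
lemma IsStronglyConvexLoss.norm_step_sq_le {μ : ℝ} (hc : IsStronglyConvexLoss ℓ μ)
    (hs : IsSmoothLoss ℓ L) (hL : 0 < L) (hη : 0 ≤ η) (hηL : η ≤ μ / L ^ 2) (z : 𝒵)
    (θ₁ θ₂ : Param d) :
    ‖(θ₁ - η • ∇ (ℓ z) θ₁) - (θ₂ - η • ∇ (ℓ z) θ₂)‖ ^ 2 ≤ (1 - η * μ) * ‖θ₁ - θ₂‖ ^ 2 := by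
  rw [norm_sub_smul_sub_sq]
  have h1 := hc z θ₁ θ₂
  have h2 := hc z θ₂ θ₁
  rw [norm_sub_rev θ₂] at h1
  rw [← neg_sub θ₁ θ₂, inner_neg_right] at h2
  have h3 : μ * ‖θ₁ - θ₂‖ ^ 2 ≤ ⟪∇ (ℓ z) θ₁ - ∇ (ℓ z) θ₂, θ₁ - θ₂⟫ := by
    rw [inner_sub_left]; linarith
  have h4 : ‖∇ (ℓ z) θ₁ - ∇ (ℓ z) θ₂‖ ^ 2 ≤ (L * ‖θ₁ - θ₂‖) ^ 2 := by
    gcongr; exact (hs z).2 θ₁ θ₂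
  rw [le_div_iff₀ (by positivity)] at hηL
  have h5 : η ^ 2 * ‖∇ (ℓ z) θ₁ - ∇ (ℓ z) θ₂‖ ^ 2 ≤ η ^ 2 * (L * ‖θ₁ - θ₂‖) ^ 2 := by gcongr
  have h6 : η * L ^ 2 * (η * ‖θ₁ - θ₂‖ ^ 2) ≤ μ * (η * ‖θ₁ - θ₂‖ ^ 2) := by gcongr
  have h7 := mul_le_mul_of_nonneg_left h3 hη
  nlinarith

lemma IsStronglyConvexLoss.hasLipschitzStep {μ : ℝ} (hc : IsStronglyConvexLoss ℓ μ)
    (hs : IsSmoothLoss ℓ L) (hL : 0 < L) (hη : 0 ≤ η) (hηL : η ≤ μ / L ^ 2) :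
    HasLipschitzStep ℓ η √(1 - η * μ) := by
  intro z θ₁ θ₂
  refine le_of_sq_le_sq ((hc.norm_step_sq_le hs hL hη hηL z θ₁ θ₂).trans ?_) (by positivity)
  rw [mul_pow]
  gcongr
  -- For a negative argument `√` is `0`, which still dominates it.
  rcases le_total 0 (1 - η * μ) with h | h
  · rw [Real.sq_sqrt h]
  · exact h.trans (sq_nonneg _)

/-- A batch step is an average of single-sample steps, so it inherits their Lipschitz constant. -/
lemma sub_smul_batchGrad_eq {ι : Type} (D : ι → 𝒵) {b : ℕ} (hb : 1 ≤ b) (batch : Fin b → ι)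
    (w : Param d) :
    w - η • batchGrad ℓ D batch w
      = (b : ℝ)⁻¹ • ∑ j, (w - η • ∇ (ℓ (D (batch j))) w) := by
  have hb0 : (b : ℝ) ≠ 0 := by positivity
  rw [batchGrad, Finset.sum_sub_distrib, smul_sub, ← Finset.smul_sum, smul_comm η]
  simp [← Nat.cast_smul_eq_nsmul ℝ, smul_smul, hb0]

lemma HasLipschitzStep.batch {q : ℝ} (h : HasLipschitzStep ℓ η q) {ι : Type} (D : ι → 𝒵) {b : ℕ}
    (hb : 1 ≤ b) (batch : Fin b → ι) (w₁ w₂ : Param d) :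
    ‖(w₁ - η • batchGrad ℓ D batch w₁) - (w₂ - η • batchGrad ℓ D batch w₂)‖
      ≤ q * ‖w₁ - w₂‖ := by
  have hb0 : 0 < (b : ℝ) := by positivity
  rw [sub_smul_batchGrad_eq D hb, sub_smul_batchGrad_eq D hb, ← smul_sub,
    ← Finset.sum_sub_distrib, norm_smul, Real.norm_of_nonneg (by positivity),
    inv_mul_le_iff₀ hb0]
  refine (norm_sum_le_of_le _ fun j _ => h (D (batch j)) w₁ w₂).trans ?_
  simp

lemma norm_batchGrad_le {ρ : ℝ} {θ : Param d} (hρ : ∀ z, ‖∇ (ℓ z) θ‖ ≤ ρ) {ι : Type} (D : ι → 𝒵)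
    {b : ℕ} (hb : 1 ≤ b) (batch : Fin b → ι) : ‖batchGrad ℓ D batch θ‖ ≤ ρ := by
  have hb0 : 0 < (b : ℝ) := by positivity
  rw [batchGrad, norm_smul, Real.norm_of_nonneg (by positivity), inv_mul_le_iff₀ hb0]
  refine (norm_sum_le_of_le _ fun j _ => hρ (D (batch j))).trans ?_
  simp

end Step

/-! ### Expectations under discrete laws. -/

section Expectation

variable {α β : Type*}

/-- The expectation of `f` under the discrete law `p`. -/
noncomputable def discreteMean (p : PMF α) (f : α → ℝ≥0∞) : ℝ≥0∞ := ∑' a, p a * f a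

lemma mixture_apply {Ω : Type*} [MeasurableSpace Ω] (p : PMF α) (κ : α → Measure Ω) {S : Set Ω}
    (hS : MeasurableSet S) : mixture p κ S = discreteMean p fun a => κ a S := by
  rw [mixture, Measure.sum_apply _ hS]
  rfl

lemma discreteMean_pure (a : α) (f : α → ℝ≥0∞) : discreteMean (PMF.pure a) f = f a := by
  rw [discreteMean, tsum_eq_single a fun b hb => by rw [PMF.pure_apply_of_ne _ _ hb, zero_mul]]
  simp

lemma discreteMean_bind (p : PMF α) (k : α → PMF β) (f : β → ℝ≥0∞) :
    discreteMean (p.bind k) f = discreteMean p fun a => discreteMean (k a) f := by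
  simp only [discreteMean, PMF.bind_apply, ← ENNReal.tsum_mul_right, ← ENNReal.tsum_mul_left]
  rw [ENNReal.tsum_comm]
  simp only [mul_assoc]

lemma discreteMean_map (p : PMF α) (g : α → β) (f : β → ℝ≥0∞) :
    discreteMean (p.map g) f = discreteMean p (f ∘ g) := by
  rw [PMF.map, discreteMean_bind]
  simp only [Function.comp_apply, discreteMean_pure]
  rfl

lemma discreteMean_const (p : PMF α) (c : ℝ≥0∞) : discreteMean p (fun _ => c) = c := by
  rw [discreteMean, ENNReal.tsum_mul_right, p.tsum_coe, one_mul]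

lemma discreteMean_add (p : PMF α) (f g : α → ℝ≥0∞) :
    discreteMean p (fun a => f a + g a) = discreteMean p f + discreteMean p g := by
  simp only [discreteMean, mul_add, ENNReal.tsum_add]

lemma discreteMean_mono {p : PMF α} {f g : α → ℝ≥0∞} (h : ∀ a ∈ p.support, f a ≤ g a) :
    discreteMean p f ≤ discreteMean p g := by
  refine ENNReal.tsum_le_tsum fun a => ?_
  by_cases ha : a ∈ p.support
  · gcongr; exact h a ha
  · rw [(p.apply_eq_zero_iff a).2 ha, zero_mul, zero_mul]

/-- No coupling is needed, since the bound holds for every pair of support points. This is how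
checkpoints trained on different datasets are compared. -/
lemma discreteMean_le_discreteMean_add {p : PMF α} {p' : PMF β} {f : α → ℝ≥0∞} {g : β → ℝ≥0∞}
    {c : ℝ≥0∞} (h : ∀ a ∈ p.support, ∀ b ∈ p'.support, f a ≤ g b + c) :
    discreteMean p f ≤ discreteMean p' g + c := by
  rw [← discreteMean_const p (discreteMean p' g + c)]
  refine discreteMean_mono fun a ha => ?_
  rw [← discreteMean_const p' (f a), ← discreteMean_const p' c, ← discreteMean_add]
  exact discreteMean_mono fun b hb => h a ha b hb

end Expectation

/-! ### Stability and confinement of SGD. -/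

section SGD

variable {𝒵 : Type*} {d : ℕ} {ℓ : 𝒵 → Param d → ℝ} {η q ρ : ℝ} {b : ℕ}
variable {ι : Type} [Fintype ι] [Nonempty ι]

/-- Coupling two runs of SGD through their batches: their distance grows at most by the factor
`q` at each step. -/
lemma discreteMean_sgd_le_add (hq : HasLipschitzStep ℓ η q) (hq0 : 0 ≤ q) (hb : 1 ≤ b)
    (D : ι → 𝒵) {c : ℝ≥0∞} (k : ℕ) {f g : Param d → ℝ≥0∞} {r : ℝ} {x y : Param d}
    (hfg : ∀ w w', ‖w - w'‖ ≤ r * q ^ k → f w ≤ g w' + c) (hxy : ‖x - y‖ ≤ r) :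
    discreteMean (sgd ℓ η b D x k) f ≤ discreteMean (sgd ℓ η b D y k) g + c := by
  induction k generalizing f g with
  | zero =>
    simp only [sgd, discreteMean_pure]
    exact hfg x y (by simpa using hxy)
  | succ k ih =>
    simp only [sgd, discreteMean_bind, discreteMean_map]
    refine ih fun w w' hw => ?_
    -- Putting `c` under the same average allows a comparison batch by batch, which is the coupling.
    rw [← discreteMean_const (PMF.uniformOfFintype (Fin b → ι)) c, ← discreteMean_add]
    refine discreteMean_mono fun batch _ => ?_
    refine hfg _ _ ((hq.batch D hb batch w w').trans ?_)
    calc q * ‖w - w'‖ ≤ q * (r * q ^ k) := by gcongr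
      _ = r * q ^ (k + 1) := by ring

/-- The SGD iterates stay within a deterministic distance of the initial point, governed by the
size of the gradients there. -/
lemma norm_sub_le_of_mem_support_sgd (hq : HasLipschitzStep ℓ η q) (hq0 : 0 ≤ q) (hη : 0 ≤ η)
    (hb : 1 ≤ b) {θ₀ : Param d} (hρ : ∀ z, ‖∇ (ℓ z) θ₀‖ ≤ ρ) (D : ι → 𝒵) (t : ℕ) {θ : Param d}
    (hθ : θ ∈ (sgd ℓ η b D θ₀ t).support) :
    ‖θ - θ₀‖ ≤ η * ρ * ∑ j ∈ Finset.range t, q ^ j := by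
  induction t generalizing θ with
  | zero =>
    simp only [sgd, PMF.support_pure, Set.mem_singleton_iff] at hθ
    simp [hθ]
  | succ t ih =>
    simp only [sgd, PMF.mem_support_bind_iff, PMF.mem_support_map_iff] at hθ
    obtain ⟨w, hw, batch, _, rfl⟩ := hθ
    have h1 := hq.batch D hb batch w θ₀
    have h2 : ‖η • batchGrad ℓ D batch θ₀‖ ≤ η * ρ := by
      rw [norm_smul, Real.norm_of_nonneg hη]
      gcongr
      exact norm_batchGrad_le hρ D hb batch
    -- The step from `θ₀` with the same batch is inserted, so only gradients at `θ₀` need a bound.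
    calc ‖w - η • batchGrad ℓ D batch w - θ₀‖
        = ‖((w - η • batchGrad ℓ D batch w) - (θ₀ - η • batchGrad ℓ D batch θ₀))
            - η • batchGrad ℓ D batch θ₀‖ := by congr 1; abel
      _ ≤ q * ‖w - θ₀‖ + η * ρ := (norm_sub_le _ _).trans (add_le_add h1 h2)
      _ ≤ q * (η * ρ * ∑ j ∈ Finset.range t, q ^ j) + η * ρ := by gcongr; exact ih hw
      _ = η * ρ * ∑ j ∈ Finset.range (t + 1), q ^ j := by
        rw [geom_sum_succ]; ring

end SGD

/-! ### From Lipschitz steps to certified unlearning. -/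

section Certification

variable {𝒵 : Type*} {d : ℕ} {ℓ : 𝒵 → Param d → ℝ} {η q ρ L B C ℓ₀ : ℝ} {b : ℕ}

/-- Unlearning reads only the checkpoint, so the last training iterate integrates out to total mass
`1`. -/
lemma r2dUnlearn_law_apply {ι ι' : Type} [Fintype ι] [Nonempty ι] [Fintype ι'] [Nonempty ι']
    (D : ι → 𝒵) (D' : ι' → 𝒵) (T K : ℕ) (θ₀ : Param d) (σ : ℝ) {S : Set (Param d)}
    (hS : MeasurableSet S) :
    mixture ((r2dLearn ℓ η b T K θ₀ σ).train ι D)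
        (fun s => mixture (sgd ℓ η b D' s.1 K) (gaussianAround σ)) S
      = discreteMean (sgd ℓ η b D θ₀ (T - K)) fun c =>
          discreteMean (sgd ℓ η b D' c K) fun w => gaussianAround σ w S := by
  rw [mixture_apply _ _ hS, r2dLearn]
  simp only [discreteMean_bind, discreteMean_map, Function.comp_def, discreteMean_const,
    mixture_apply _ _ hS]

lemma r2dLearn_law_apply {ι : Type} [Fintype ι] [Nonempty ι]
    (D : ι → 𝒵) (T K : ℕ) (θ₀ : Param d) (σ : ℝ) {S : Set (Param d)} (hS : MeasurableSet S) :
    (r2dLearn ℓ η b T K θ₀ σ).law D S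
      = discreteMean (sgd ℓ η b D θ₀ (T - K)) fun c =>
          discreteMean (sgd ℓ η b D c K) fun w => gaussianAround σ w S := by
  rw [LearningAlgorithm.law, mixture_apply _ _ hS, r2dLearn]
  simp only [discreteMean_bind, discreteMean_map, Function.comp_def]

/-- Two SGD runs from `θ₀`, on any datasets, followed by `K` coupled steps on a common dataset,
lead to Gaussian outputs at total variation distance at most `2 δ`. -/
lemma discreteMean_sgd_gaussianAround_le (hq : HasLipschitzStep ℓ η q) (hq0 : 0 ≤ q) (hη : 0 ≤ η)
    (hb : 1 ≤ b) {θ₀ : Param d} (hρ : ∀ z, ‖∇ (ℓ z) θ₀‖ ≤ ρ) {N K : ℕ} {Sig ε δ : ℝ}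
    (hε : 0 < ε) (hε1 : ε ≤ 1) (hδ : 0 < δ)
    (hSig : 2 * (η * ρ * ∑ j ∈ Finset.range N, q ^ j) * q ^ K ≤ Sig)
    {ι₁ ι₂ ι₃ : Type} [Fintype ι₁] [Nonempty ι₁] [Fintype ι₂] [Nonempty ι₂] [Fintype ι₃]
    [Nonempty ι₃] (D₁ : ι₁ → 𝒵) (D₂ : ι₂ → 𝒵) (D₃ : ι₃ → 𝒵) {S : Set (Param d)}
    (hS : MeasurableSet S) :
    (discreteMean (sgd ℓ η b D₁ θ₀ N) fun c => discreteMean (sgd ℓ η b D₃ c K) fun w =>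
        gaussianAround (noiseLevel Sig ε δ) w S)
      ≤ (discreteMean (sgd ℓ η b D₂ θ₀ N) fun c => discreteMean (sgd ℓ η b D₃ c K) fun w =>
          gaussianAround (noiseLevel Sig ε δ) w S) + ENNReal.ofReal (2 * δ) := by
  refine discreteMean_le_discreteMean_add fun c hc c' hc' => ?_
  refine discreteMean_sgd_le_add (r := 2 * (η * ρ * ∑ j ∈ Finset.range N, q ^ j)) hq hq0 hb D₃ K
    (fun w w' hw => gaussianAround_noiseLevel_le hε hε1 hδ (hw.trans hSig) hS) ?_
  have h1 := norm_sub_le_of_mem_support_sgd hq hq0 hη hb hρ D₁ N hc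
  have h2 := norm_sub_le_of_mem_support_sgd hq hq0 hη hb hρ D₂ N hc'
  calc ‖c - c'‖ = ‖(c - θ₀) - (c' - θ₀)‖ := by congr 1; abel
    _ ≤ ‖c - θ₀‖ + ‖c' - θ₀‖ := norm_sub_le _ _
    _ ≤ _ := by linarith

lemma indistinguishable_of_le_add {Ω : Type*} [MeasurableSpace Ω] {ε δ : ℝ} (hε : 0 ≤ ε)
    {P Q : Measure Ω}
    (h : ∀ S, MeasurableSet S → P S ≤ Q S + ENNReal.ofReal δ ∧ Q S ≤ P S + ENNReal.ofReal δ) :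
    Indistinguishable ε δ P Q := by
  have h1 : ∀ x : ℝ≥0∞, x ≤ ENNReal.ofReal (Real.exp ε) * x := fun x =>
    le_mul_of_one_le_left' (by simpa using hε)
  exact fun S hS => ⟨(h S hS).1.trans (by gcongr; exact h1 _),
    (h S hS).2.trans (by gcongr; exact h1 _)⟩

/-- The bound `ρ` may depend on a sample because `𝒵` may be empty, and then nothing forces `0 ≤ ℓ₀`.
A dataset of size `n > m` supplies the sample. -/
lemma sgdR2DUnlearns_of_hasLipschitzStep (hq : HasLipschitzStep ℓ η q) (hq0 : 0 ≤ q)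
    (hη : 0 ≤ η) (hb : 1 ≤ b) {θ₀ : Param d} {T K n m : ℕ} (hmn : m < n) {Sig ε δ : ℝ}
    (hε : 0 < ε) (hε1 : ε ≤ 1) (hδ : 0 < δ)
    (hρ : 𝒵 → ∃ ρ, (∀ z, ‖∇ (ℓ z) θ₀‖ ≤ ρ) ∧
      2 * (η * ρ * ∑ j ∈ Finset.range (T - K), q ^ j) * q ^ K ≤ Sig) :
    SGDR2DUnlearns ℓ η b T K θ₀ n m (noiseLevel Sig ε δ) ε (2 * δ) := by
  intro D Z _ _ _
  obtain ⟨ρ, hρ, hSig⟩ := hρ (D ⟨0, by omega⟩)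
  refine indistinguishable_of_le_add hε.le fun S hS => ?_
  -- The two `Fintype` structures on the retained indices come from different decidability instances
  -- and must be identified.
  have hdec : (Classical.decPred fun i => i ∉ Z) = fun i => instDecidableNot :=
    Subsingleton.elim _ _
  have hP : mixture ((r2dLearn ℓ η b T K θ₀ (noiseLevel Sig ε δ)).train (Fin n) D)
      (r2dUnlearn ℓ η b K (noiseLevel Sig ε δ) Z D) S
      = discreteMean (sgd ℓ η b D θ₀ (T - K)) fun c =>
          discreteMean (sgd ℓ η b (retained D Z) c K) fun w =>
            gaussianAround (noiseLevel Sig ε δ) w S := by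
    unfold r2dUnlearn
    rw [hdec]
    exact r2dUnlearn_law_apply D (retained D Z) T K θ₀ _ hS
  rw [hP, r2dLearn_law_apply _ _ _ _ _ hS]
  exact ⟨discreteMean_sgd_gaussianAround_le hq hq0 hη hb hρ hε hε1 hδ hSig _ _ _ hS,
    discreteMean_sgd_gaussianAround_le hq hq0 hη hb hρ hε hε1 hδ hSig _ _ _ hS⟩

/-- On a one-point dataset the empirical loss is `ℓ z` itself. For `B < 1` this bounds the gradient
by `C` alone. -/
lemma HasRelBoundedSecondMoment.norm_gradient_sq_le (hm : HasRelBoundedSecondMoment ℓ b B C)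
    (z : 𝒵) (θ : Param d) : ‖∇ (ℓ z) θ‖ ^ 2 ≤ B * ‖∇ (ℓ z) θ‖ ^ 2 + C := by
  have h := (hm Unit (fun _ => z) θ).2
  have : empLoss ℓ (fun _ : Unit => z) = ℓ z := by ext; simp [empLoss]
  simpa [this] using h

/-- The square of the noise factor is at least `18 B ℓ₀ / η + 24 C`. -/
lemma le_noiseFactor {L B C ℓ₀ η x : ℝ} {n m T K : ℕ} (hL : 0 ≤ L) (hB : 0 ≤ B) (hC : 0 ≤ C)
    (hη : 0 < η) (hℓ₀ : 0 ≤ ℓ₀) (hKT : K ≤ T) (hmn : m < n)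
    (hx : x ^ 2 ≤ 18 * (B * (ℓ₀ / η)) + 24 * C) :
    x ≤ noiseFactor L B C ℓ₀ η n m T K := by
  refine Real.le_sqrt_of_sq_le (hx.trans ?_)
  have hmn' : (0 : ℝ) < n - m := sub_pos.2 (by exact_mod_cast hmn)
  have hKT' : (0 : ℝ) ≤ T - K := sub_nonneg.2 (by exact_mod_cast hKT)
  have h1 : (3 : ℝ) ≤ (3 * n - m) / (n - m) := by
    rw [le_div_iff₀ hmn']; linarith [(Nat.cast_nonneg m : (0 : ℝ) ≤ m)]
  have h2 : (4 : ℝ) ≤ (4 * n - 3 * m) / (n - m) := by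
    rw [le_div_iff₀ hmn']; linarith [(Nat.cast_nonneg m : (0 : ℝ) ≤ m)]
  have h3 : 3 * B * (2 / η * ℓ₀) * 3
      ≤ 3 * B * (2 / η * ℓ₀ + L * η * C * (T - K)) * ((3 * n - m) / (n - m)) := by
    gcongr
    exact le_add_of_nonneg_right (by positivity)
  have h4 : 6 * 4 * C ≤ 6 * ((4 * n - 3 * m) / (n - m)) * C := by gcongr
  have h5 : 3 * B * (2 / η * ℓ₀) * 3 = 18 * (B * (ℓ₀ / η)) := by ring
  linarith

end Certification

end Unlearning

/-! ### Comparing the gradient bound with `R` in the three cases. -/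

open Unlearning

theorem theorem2 {𝒵 : Type*} {d : ℕ} (ℓ : 𝒵 → Unlearning.Param d → ℝ) (θ₀ : Unlearning.Param d)
    (L B C ℓ₀ η ε δ : ℝ) (b T K n m : ℕ)
    (hL : 0 < L) (hB : 0 ≤ B) (hC : 0 ≤ C) (hη : 0 < η)
    (hε : 0 < ε) (hε1 : ε ≤ 1) (hδ : 0 < δ) (hδ1 : δ < 1)
    (hb : 1 ≤ b) (hKT : K ≤ T) (hmn : m < n)
    (hsmooth : Unlearning.IsSmoothLoss ℓ L)
    (hmoment : Unlearning.HasRelBoundedSecondMoment ℓ b B C)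
    (hinit : Unlearning.IsBoundedAtInit ℓ θ₀ ℓ₀) :
    -- general losses
    (η * (L * B) ≤ 1 →
      Unlearning.SGDR2DUnlearns ℓ η b T K θ₀ n m
        (Unlearning.noiseLevel
          (((1 + η * L) ^ T - (1 + η * L) ^ K) / L
            * Unlearning.noiseFactor L B C ℓ₀ η n m T K) ε δ)
        ε (2 * δ)) ∧
    -- convex losses
    (Unlearning.IsConvexLoss ℓ → η ≤ 2 / L →
      Unlearning.SGDR2DUnlearns ℓ η b T K θ₀ n m
        (Unlearning.noiseLevel
          (η * ((T : ℝ) - K) * Unlearning.noiseFactor L B C ℓ₀ η n m T K) ε δ)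
        ε (2 * δ)) ∧
    -- strongly convex losses
    (∀ μ γ : ℝ, 0 < μ → Unlearning.IsStronglyConvexLoss ℓ μ → η ≤ μ / L ^ 2 →
      γ = √(1 - η * μ) →
      Unlearning.SGDR2DUnlearns ℓ η b T K θ₀ n m
        (Unlearning.noiseLevel
          ((γ ^ K - γ ^ T) / μ * Unlearning.noiseFactor L B C ℓ₀ η n m T K) ε δ)
        ε (2 * δ)) := by
  have hgrad : ∀ z, ‖∇ (ℓ z) θ₀‖ ^ 2 ≤ 2 * L * ℓ₀ := fun z =>
    (norm_gradient_sq_le hL (hsmooth z).1 (hsmooth z).2 (hinit.1 z) θ₀).trans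
      (by gcongr; exact hinit.2 z)
  have hself := fun z => hmoment.norm_gradient_sq_le z θ₀
  have hℓ₀ : ∀ z : 𝒵, 0 ≤ ℓ₀ := fun z => (hinit.1 z θ₀).trans (hinit.2 z)
  have hfactor : ∀ {x : ℝ}, 𝒵 → x ^ 2 ≤ 18 * (B * (ℓ₀ / η)) + 24 * C →
      x ≤ noiseFactor L B C ℓ₀ η n m T K := fun z hx =>
    le_noiseFactor hL.le hB hC hη (hℓ₀ z) hKT hmn hx
  set R := noiseFactor L B C ℓ₀ η n m T K
  have hR : 0 ≤ R := Real.sqrt_nonneg _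
  have hTK : T - K + K = T := Nat.sub_add_cancel hKT
  refine ⟨fun hηLB => ?_, fun hconv hηL => ?_, fun μ γ hμ hconv hηL hγ => ?_⟩
  · refine sgdR2DUnlearns_of_hasLipschitzStep (hsmooth.hasLipschitzStep hη.le) (by positivity)
      hη.le hb hmn hε hε1 hδ fun _ => ⟨R / 2, fun z => ?_, le_of_eq ?_⟩
    · have h1 : 2 * ‖∇ (ℓ z) θ₀‖ ≤ R := by
        refine hfactor z ?_
        set a := ‖∇ (ℓ z) θ₀‖ ^ 2 with ha
        have ha0 : 0 ≤ a := sq_nonneg _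
        have h2 : B * (L * B) ≤ B * (1 / η) := by
          gcongr
          rw [le_div_iff₀ hη]
          linarith
        have h3 : 9 * B ^ 2 * a ≤ 18 * (B * (ℓ₀ / η)) := by
          calc 9 * B ^ 2 * a ≤ 9 * B ^ 2 * (2 * L * ℓ₀) := by gcongr; exact hgrad z
            _ = 18 * (B * (L * B)) * ℓ₀ := by ring
            _ ≤ 18 * (B * (1 / η)) * ℓ₀ := by gcongr; exact hℓ₀ z
            _ = 18 * (B * (ℓ₀ / η)) := by ring
        have h4 : (2 * ‖∇ (ℓ z) θ₀‖) ^ 2 = 4 * a := by rw [ha]; ring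
        have h5 := hself z
        -- With `C ≥ (1 - B) a`, the sum `9B²a + 24C` is at least `((3B - 4)² + 8) a ≥ 4a`.
        nlinarith [mul_nonneg ha0 (sq_nonneg (3 * B - 4))]
      linarith
    · have h1 := geom_sum_mul (1 + η * L) (T - K)
      rw [add_sub_cancel_left] at h1
      have h2 : (1 + η * L) ^ T = (1 + η * L) ^ (T - K) * (1 + η * L) ^ K := by
        rw [← pow_add, hTK]
      rw [h2, div_mul_eq_mul_div, eq_div_iff hL.ne']
      linear_combination (R * (1 + η * L) ^ K) * h1
  · refine sgdR2DUnlearns_of_hasLipschitzStep (hconv.hasLipschitzStep hsmooth hL hη.le hηL)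
      zero_le_one hη.le hb hmn hε hε1 hδ fun _ => ⟨R / 2, fun z => ?_, le_of_eq ?_⟩
    · have h1 : 2 * ‖∇ (ℓ z) θ₀‖ ≤ R := by
        refine hfactor z ?_
        have h2 : L * ℓ₀ ≤ 2 * (ℓ₀ / η) := by
          rw [le_div_iff₀ hL] at hηL
          rw [← mul_div_assoc, le_div_iff₀ hη]
          nlinarith [mul_le_mul_of_nonneg_left hηL (hℓ₀ z)]
        have h3 : B * ‖∇ (ℓ z) θ₀‖ ^ 2 ≤ 4 * (B * (ℓ₀ / η)) := by
          calc B * ‖∇ (ℓ z) θ₀‖ ^ 2 ≤ B * (2 * L * ℓ₀) := by gcongr; exact hgrad z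
            _ = 2 * (B * (L * ℓ₀)) := by ring
            _ ≤ 2 * (B * (2 * (ℓ₀ / η))) := by gcongr
            _ = 4 * (B * (ℓ₀ / η)) := by ring
        have h4 : 0 ≤ B * (ℓ₀ / η) := mul_nonneg hB (div_nonneg (hℓ₀ z) hη.le)
        have h5 := hself z
        rw [mul_pow]
        linarith
      linarith
    · rw [← Nat.cast_sub hKT]
      simp
      ring
  · have hγ0 : 0 ≤ γ := hγ ▸ Real.sqrt_nonneg _
    have hstep := hconv.norm_step_sq_le hsmooth hL hη.le hηL
    have hγ1 : γ ≤ 1 := by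
      rw [hγ, Real.sqrt_le_iff]
      refine ⟨zero_le_one, ?_⟩
      linarith [mul_pos hη hμ]
    have hq : HasLipschitzStep ℓ η γ := hγ ▸ hconv.hasLipschitzStep hsmooth hL hη.le hηL
    refine sgdR2DUnlearns_of_hasLipschitzStep hq hγ0 hη.le hb hmn hε hε1 hδ fun z₀ => ?_
    rcases le_or_gt (η * μ) 1 with hημ | hημ
    · have hγ2 : γ ^ 2 = 1 - η * μ := by rw [hγ, Real.sq_sqrt (by linarith)]
      -- The geometric sum has denominator `1 - γ` while `ημ = (1 - γ)(1 + γ)`; this `ρ` makes the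
      -- drift bound equal to `Σ`.
      refine ⟨R / (2 * (1 + γ)), fun z => ?_, le_of_eq ?_⟩
      · rw [le_div_iff₀ (by positivity)]
        refine hfactor z ?_
        set a := ‖∇ (ℓ z) θ₀‖ ^ 2 with ha
        have ha0 : 0 ≤ a := sq_nonneg _
        set u := η * L with hu
        have hu0 : 0 < u := mul_pos hη hL
        have huγ : u ^ 2 ≤ 1 - γ ^ 2 := by
          rw [le_div_iff₀ (by positivity)] at hηL
          nlinarith
        -- Under `u² ≤ 1 - γ²` the left side is largest at `γ = 2/3`, `u = √5/3`. Linearising `u` by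
        -- AM-GM at the nearby value `3/4` leaves a polynomial inequality in `γ`.
        have hpoly : 4 * u * (1 + γ) ^ 2 ≤ 9 := by
          have h1 : u ≤ 2 / 3 * (1 - γ ^ 2) + 3 / 8 := by nlinarith [sq_nonneg (u - 3 / 4)]
          have h2 : 4 * u * (1 + γ) ^ 2 ≤ 4 * (2 / 3 * (1 - γ ^ 2) + 3 / 8) * (1 + γ) ^ 2 := by
            gcongr
          nlinarith [sq_nonneg (γ ^ 2 + γ - 10 / 9), sq_nonneg (γ - 2 / 3)]
        have h2 : 4 * (1 + γ) ^ 2 * (B * a) ≤ 18 * (B * (ℓ₀ / η)) := by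
          have h3 : a ≤ u * (2 * (ℓ₀ / η)) := by
            refine (hgrad z).trans (le_of_eq ?_)
            rw [hu]; field_simp
          have h4 : 0 ≤ ℓ₀ / η := div_nonneg (hℓ₀ z) hη.le
          calc 4 * (1 + γ) ^ 2 * (B * a)
              ≤ 4 * (1 + γ) ^ 2 * (B * (u * (2 * (ℓ₀ / η)))) := by gcongr
            _ = (4 * u * (1 + γ) ^ 2) * (2 * (B * (ℓ₀ / η))) := by ring
            _ ≤ 9 * (2 * (B * (ℓ₀ / η))) := by gcongr
            _ = 18 * (B * (ℓ₀ / η)) := by ring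
        have h3 : 4 * (1 + γ) ^ 2 * C ≤ 24 * C := by
          have : (1 + γ) ^ 2 ≤ (1 + 1) ^ 2 := by gcongr
          gcongr
          linarith
        calc (‖∇ (ℓ z) θ₀‖ * (2 * (1 + γ))) ^ 2 = 4 * (1 + γ) ^ 2 * a := by rw [ha]; ring
          _ ≤ 4 * (1 + γ) ^ 2 * (B * a + C) := by gcongr; exact hself z
          _ ≤ _ := by linarith
      · have h1 := geom_sum_mul γ (T - K)
        have h2 : γ ^ T = γ ^ (T - K) * γ ^ K := by rw [← pow_add, hTK]
        rw [h2]
        have h3 : η * μ = (1 - γ) * (1 + γ) := by linear_combination hγ2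
        have h4 : (1 + γ) ≠ 0 := by positivity
        field_simp
        linear_combination (γ ^ K * R * (∑ j ∈ Finset.range (T - K), γ ^ j)) * h3
          - (γ ^ K * R * (1 + γ)) * h1
    -- If `ημ > 1`, the squared contraction factor is negative, so any two parameters coincide and
    -- all gradients vanish.
    · have hsub : Subsingleton (Param d) := by
        refine ⟨fun θ₁ θ₂ => sub_eq_zero.1 (norm_eq_zero.1 ?_)⟩
        by_contra hne
        have h1 := hstep z₀ θ₁ θ₂
        have h2 : 0 < ‖θ₁ - θ₂‖ ^ 2 := by positivity
        nlinarith [sq_nonneg ‖θ₁ - η • ∇ (ℓ z₀) θ₁ - (θ₂ - η • ∇ (ℓ z₀) θ₂)‖]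
      refine ⟨0, fun z => by rw [Subsingleton.elim (∇ (ℓ z) θ₀) 0, norm_zero], ?_⟩
      have h1 : 0 ≤ γ ^ K - γ ^ T := sub_nonneg.2 (pow_le_pow_of_le_one hγ0 hγ1 hKT)
      simp only [mul_zero, zero_mul]
      positivity
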